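/- Let $n\ge 1$, $T>0$, $\ell_1,\dots,\ell_n\in\{1,2,\dots\}$, $\Omega=(0,\ell_1)\times\dots\times(0,\ell_n)$, $Y=(0,1)^n$, $\mathfrak m=\frac12(1,\dots,1)$, $0<\overline R<\frac12$ and $\Gamma=\partial B_{\overline R}(\mathfrak m)\subset Y$. Let $\epsilon$ run through a sequence of positive numbers with $\epsilon^{-1}\in\mathbb N$ and $\epsilon\to0$; put $K_\epsilon=\{k\in\mathbb Z^n:\epsilon(Y+k)\subset\Omega\}$, $\Gamma_\epsilon(z)=\epsilon\Gamma+z$ for $z\in\mathbb R^n$, and $\Gamma_\epsilon=\bigcup_{k\in K_\epsilon}\Gamma_\epsilon(\epsilon k)$. Let $\sigma$ be the $(n-1)$-dimensional surface measure (counting measure if $n=1$), $|\epsilon\Gamma|=\sigma(\epsilon\Gamma)$, and let $[x]$ denote the componentwise integer part of $x\in\mathbb R^n$. A sequence $w_\epsilon\in L^1((0,T)\times\Gamma_\epsilon)$ is said to converge strongly in the two-scale sense on $\Gamma_\epsilon$ in $L^1$ to $u_0\in L^1((0,T)\times\Omega\times\Gamma)$ if for every $\phi\in C([0,T]\times\overline\Omega,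 C_{\mathrm{per}}(\Gamma))$ (continuous, and extended $Y$-periodically in the last variable) $$\lim_{\epsilon\to0}\epsilon\int_0^T\!\!\int_{\Gamma_\epsilon}w_\epsilon(t,x)\,\phi\!\left(t,x,\tfrac x\epsilon\right)d\sigma\,dt=\int_0^T\!\!\int_\Omega\int_\Gamma u_0(t,x,y)\,\phi(t,x,y)\,d\sigma_y\,dx\,dt$$ and $$\lim_{\epsilon\to0}\epsilon\left\|w_\epsilon-\phi\!\left(\cdot,\cdot,\tfrac{\cdot}{\epsilon}\right)\right\|_{L^1((0,T)\times\Gamma_\epsilon)}=\|u_0-\phi\|_{L^1((0,T)\times\Omega\times\Gamma)}.$$ (Equivalently, the unfolded functions $(t,x,y)\mapsto w_\epsilon(t,\epsilon[x/\epsilon]+\epsilon y)$ converge to $u_0$ in the norm of $L^1((0,T)\times\Omega\times\Gamma)$.) **Lemma.** Let $w_\epsilon\in L^1((0,T)\times\Gamma_\epsilon)$ and $w_0\in L^1((0,T),W^{1,1}(\Omega))$ be such that $w_\epsilon\to w_0$ strongly in the two-scale sense on $\Gamma_\epsilon$ in $L^1$ (where $w_0$ is regarded as the function $(t,x,y)\mapsto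 w_0(t,x)$). Then the functions $$(t,x)\longmapsto\frac1{|\epsilon\Gamma|}\int_{\Gamma_\epsilon\left(\epsilon\left[\frac x\epsilon\right]\right)}w_\epsilon(t,z)\,d\sigma_z$$ belong to $L^1((0,T)\times\Omega)$ and converge to $w_0$ in $L^1((0,T)\times\Omega)$ as $\epsilon\to0$. -/

import Mathlib

open MeasureTheory Set Filter Topology
open scoped ContDiff Pointwise

noncomputable section

namespace TwoScale

/-- Euclidean space `ℝⁿ`. -/
abbrev Space (n : ℕ) : Type := EuclideanSpace ℝ (Fin n)

variable {n : ℕ}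

/-- The macroscopic domain `Ω = (0, ℓ₁) × ⋯ × (0, ℓₙ)`. -/
def macroDomain (ℓ : Fin n → ℕ) : Set (Space n) :=
  {x | ∀ i, 0 < x i ∧ x i < (ℓ i : ℝ)}

/-- The unit cell `Y = (0,1)ⁿ`. -/
def unitCell (n : ℕ) : Set (Space n) := {y | ∀ i, 0 < y i ∧ y i < 1}

/-- An integer vector seen as a point of `ℝⁿ`. -/
def intVec (k : Fin n → ℤ) : Space n := WithLp.toLp 2 fun i => (k i : ℝ)

/-- The componentwise integer part `[x]`. -/
def intPart (x : Space n) : Fin n → ℤ := fun i => ⌊x i⌋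

/-- The componentwise fractional part `x - [x]`. -/
def fracPart (x : Space n) : Space n := x - intVec (intPart x)

/-- `K_ε = {k ∈ ℤⁿ : ε (Y + k) ⊆ Ω}`. -/
def cellIndices (ℓ : Fin n → ℕ) (ε : ℝ) : Set (Fin n → ℤ) :=
  {k | ∀ y ∈ unitCell n, ε • (y + intVec k) ∈ macroDomain ℓ}

/-- The reference surface `Γ = ∂B_R(𝔪)`, with `𝔪 = (1/2, …, 1/2)` the center of the unit cell. -/
def refSurface (n : ℕ) (R : ℝ) : Set (Space n) :=
  Metric.sphere (WithLp.toLp 2 fun _ => (1 / 2 : ℝ)) R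

/-- `Γ_ε(z) = ε Γ + z`. -/
def cellSurface (R ε : ℝ) (z : Space n) : Set (Space n) :=
  (fun y => ε • y + z) '' refSurface n R

/-- The oscillating surface `Γ_ε`: the union of the spheres `ε (Γ + k)`, `k ∈ K_ε`. -/
def oscSurface (ℓ : Fin n → ℕ) (R ε : ℝ) : Set (Space n) :=
  ⋃ k ∈ cellIndices ℓ ε, cellSurface R ε (ε • intVec k)

/-- The surface measure `σ`: the `(n-1)`-dimensional Hausdorff measure in its Euclidean
normalization. -/
def surfMeasure (n : ℕ) : Measure (Space n) := Measure.euclideanHausdorffMeasure (n - 1)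

/-- The measure `dt` on `(0,T)`. -/
def timeMeasure (T : ℝ) : Measure ℝ := volume.restrict (Ioo 0 T)

/-- The measure `dx dt` on `(0,T) × Ω`. -/
def macroMeasure (T : ℝ) (ℓ : Fin n → ℕ) : Measure (ℝ × Space n) :=
  (timeMeasure T).prod (volume.restrict (macroDomain ℓ))

/-- The measure `dσ dt` on `(0,T) × Γ_ε`. -/
def oscMeasure (T : ℝ) (ℓ : Fin n → ℕ) (R ε : ℝ) : Measure (ℝ × Space n) :=
  (timeMeasure T).prod ((surfMeasure n).restrict (oscSurface ℓ R ε))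

/-- The measure `dσ_y dx dt` on `(0,T) × Ω × Γ`. -/
def twoScaleMeasure (T : ℝ) (ℓ : Fin n → ℕ) (R : ℝ) : Measure (ℝ × Space n × Space n) :=
  (timeMeasure T).prod
    ((volume.restrict (macroDomain ℓ)).prod ((surfMeasure n).restrict (refSurface n R)))

/-- Test functions `φ ∈ C([0,T] × closure Ω, C_per(Γ))`. As `Γ` lies inside the unit cell, such a
function is given by its (jointly continuous) values on `[0,T] × closure Ω × Γ`. -/
def IsTestFunction (T : ℝ) (ℓ : Fin n → ℕ) (R : ℝ) (φ : ℝ × Space n × Space n → ℝ) : Prop :=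
  ContinuousOn φ (Icc 0 T ×ˢ closure (macroDomain ℓ) ×ˢ refSurface n R)

/-- The function `(t, x) ↦ φ(t, x, x/ε)`, where `φ` is extended periodically in its last
variable from the unit cell. -/
def oscillate (ε : ℝ) (φ : ℝ × Space n × Space n → ℝ) : ℝ × Space n → ℝ :=
  fun p => φ (p.1, p.2, fracPart (ε⁻¹ • p.2))

/-- (Weak) two-scale convergence on the surfaces `Γ_ε` in `L¹`, along `ε = ε_j`. -/
def TwoScaleTendsto (T : ℝ) (ℓ : Fin n → ℕ) (R : ℝ) (ε : ℕ → ℝ) (w : ℕ → ℝ × Space n → ℝ)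
    (u₀ : ℝ × Space n × Space n → ℝ) : Prop :=
  ∀ φ : ℝ × Space n × Space n → ℝ, IsTestFunction T ℓ R φ →
    Tendsto (fun j => ε j * ∫ p, w j p * oscillate (ε j) φ p ∂(oscMeasure T ℓ R (ε j))) atTop
      (𝓝 (∫ q, u₀ q * φ q ∂(twoScaleMeasure T ℓ R)))

/-- Strong two-scale convergence on the surfaces `Γ_ε` in `L¹`, along `ε = ε_j`: two-scale
convergence together with the convergence of the norms
`ε ‖w_ε - φ(·,·,·/ε)‖_{L¹((0,T)×Γ_ε)} → ‖u₀ - φ‖_{L¹((0,T)×Ω×Γ)}`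
for every test function `φ`. The case `φ = 0` is `ε ‖w_ε‖ → ‖u₀‖`; in `L¹`, which is not uniformly
convex, that case alone would not exclude oscillations such as `w_ε = 1 + sin (2πt/ε)`. -/
structure StrongTwoScaleTendsto (T : ℝ) (ℓ : Fin n → ℕ) (R : ℝ) (ε : ℕ → ℝ)
    (w : ℕ → ℝ × Space n → ℝ) (u₀ : ℝ × Space n × Space n → ℝ) : Prop where
  twoScale : TwoScaleTendsto T ℓ R ε w u₀
  norm_tendsto : ∀ φ : ℝ × Space n × Space n → ℝ, IsTestFunction T ℓ R φ →
    Tendsto (fun j => ε j * ∫ p, |w j p - oscillate (ε j) φ p| ∂(oscMeasure T ℓ R (ε j))) atTop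
      (𝓝 (∫ q, |u₀ q - φ q| ∂(twoScaleMeasure T ℓ R)))

/-- `u ∈ W^{1,1}(U)` with weak gradient `g`. -/
structure IsW11WithGradient (U : Set (Space n)) (u : Space n → ℝ) (g : Space n → Space n) :
    Prop where
  integrable_fun : IntegrableOn u U
  integrable_grad : IntegrableOn g U
  weak_grad : ∀ ψ : Space n → ℝ, ContDiff ℝ ∞ ψ → HasCompactSupport ψ → tsupport ψ ⊆ U →
    ∀ i : Fin n, ∫ x in U, u x * fderiv ℝ ψ x (EuclideanSpace.single i 1) =
      -∫ x in U, g x i * ψ x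

/-- `w ∈ L¹((0,T), W^{1,1}(Ω))`: `w` and its weak spatial gradient are integrable on
`(0,T) × Ω`. -/
def MemL1W11 (T : ℝ) (ℓ : Fin n → ℕ) (w : ℝ × Space n → ℝ) : Prop :=
  Integrable w (macroMeasure T ℓ) ∧
    ∃ g : ℝ × Space n → Space n, Integrable g (macroMeasure T ℓ) ∧
      ∀ᵐ t ∂(timeMeasure T),
        IsW11WithGradient (macroDomain ℓ) (fun x => w (t, x)) (fun x => g (t, x))

/-- The cell-wise surface average `|εΓ|⁻¹ ∫_{Γ_ε(ε[x/ε])} w(t,z) dσ_z`. -/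
def cellAverage (R ε : ℝ) (w : ℝ × Space n → ℝ) : ℝ × Space n → ℝ :=
  fun p => ((surfMeasure n).real (ε • refSurface n R))⁻¹ *
    ∫ z in cellSurface R ε (ε • intVec (intPart (ε⁻¹ • p.2))), w (p.1, z) ∂(surfMeasure n)

end TwoScale

end

/-!
A continuous compactly supported `φ(t,x)` that is `L¹`-close to `w₀` is a test function which does
not oscillate, so the convergence of norms in the hypothesis reads
`ε ‖w_ε - φ‖_{L¹((0,T)×Γ_ε)} → |Γ| ‖w₀ - φ‖_{L¹((0,T)×Ω)}` (`integral_twoScaleMeasure_of_macro`).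
On the other side, the cell average of a function `f` is constant in `x` on each cell of side `ε`,
a cell has volume at most `εⁿ` and carries a surface of area `εⁿ⁻¹ |Γ|`; hence averaging satisfies
`‖avg f‖_{L¹((0,T)×Ω)} ≤ |Γ|⁻¹ ε ‖f‖_{L¹((0,T)×Γ_ε)}` (`integral_cellAverage_le`). Applied to
`f = |w_ε - φ|`, and since `φ` varies by at most a small `η` within a cell, this gives
`‖avg w_ε - w₀‖ ≤ |Γ|⁻¹ ε ‖w_ε - φ‖ + η T |Ω| + ‖w₀ - φ‖` (`integral_abs_cellAverage_sub_le`), whose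
right-hand side tends to `2 ‖w₀ - φ‖` up to the small error `η T |Ω|`.

No boundary layer occurs because `ε⁻¹` is an integer: the cell of each point of `Ω` lies in `Ω`
(`intPart_mem_cellIndices`). The normalization by `|εΓ|` is meaningful because
`0 < |Γ| < ∞` for the Hausdorff measure. Finiteness follows by covering the sphere with the radial
projections of the faces of a cube, which are Lipschitz images of cubes in `ℝⁿ⁻¹`
(`surfMeasure_unitSphere_lt_top`), positivity by projecting the sphere onto the unit ball of `ℝⁿ⁻¹`
(`surfMeasure_unitSphere_pos`).
-/

namespace TwoScale

variable {n : ℕ}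

/-! ### The area of a sphere is positive and finite -/

theorem euclideanHausdorffMeasure_image_le {X Y : Type*} [EMetricSpace X] [MeasurableSpace X]
    [BorelSpace X] [EMetricSpace Y] [MeasurableSpace Y] [BorelSpace Y] {K : NNReal} {f : X → Y}
    {s : Set X} (hf : LipschitzOnWith K f s) (d : ℕ) :
    μHE[d] (f '' s) ≤ (K : ENNReal) ^ d * μHE[d] s := by
  have h := hf.hausdorffMeasure_image_le (d := (d : ℝ)) (by positivity)
  rw [Measure.euclideanHausdorffMeasure_def, Measure.euclideanHausdorffMeasure_def,
    Measure.smul_apply, Measure.smul_apply, ENNReal.smul_def, ENNReal.smul_def, smul_eq_mul,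
    smul_eq_mul, mul_left_comm]
  rw [ENNReal.rpow_natCast] at h
  gcongr

/-- The radial projection onto the unit sphere is `2`-Lipschitz outside the open unit ball. -/
theorem lipschitzOnWith_normalize {E : Type*} [NormedAddCommGroup E] [NormedSpace ℝ E] :
    LipschitzOnWith 2 (fun x : E => ‖x‖⁻¹ • x) {x | 1 ≤ ‖x‖} := by
  refine LipschitzOnWith.of_dist_le_mul fun x hx y hy => ?_
  simp only [mem_ofPred_eq] at hx hy
  have hx0 : ‖x‖ ≠ 0 := by positivity
  have hy0 : ‖y‖ ≠ 0 := by positivity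
  have e : ‖x‖⁻¹ • x - ‖y‖⁻¹ • y = ‖x‖⁻¹ • (x - y) + ((‖x‖⁻¹ * (‖y‖ - ‖x‖)) * ‖y‖⁻¹) • y := by
    have : (‖x‖⁻¹ * (‖y‖ - ‖x‖)) * ‖y‖⁻¹ = ‖x‖⁻¹ - ‖y‖⁻¹ := by field_simp
    rw [this]; module
  rw [dist_eq_norm, dist_eq_norm, e]
  have h1 : ‖x‖⁻¹ ≤ 1 := inv_le_one_of_one_le₀ hx
  have h2 : |‖y‖ - ‖x‖| ≤ ‖x - y‖ := by
    rw [norm_sub_rev]; exact abs_norm_sub_norm_le y x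
  calc _ ≤ ‖‖x‖⁻¹ • (x - y)‖ + ‖((‖x‖⁻¹ * (‖y‖ - ‖x‖)) * ‖y‖⁻¹) • y‖ := norm_add_le _ _
    _ = ‖x‖⁻¹ * ‖x - y‖ + ‖x‖⁻¹ * |‖y‖ - ‖x‖| := by
      rw [norm_smul, norm_smul, norm_mul, norm_mul, norm_inv, norm_inv, norm_norm, norm_norm,
        inv_mul_cancel_right₀ hy0, Real.norm_eq_abs]
    _ ≤ 1 * ‖x - y‖ + 1 * ‖x - y‖ := by gcongr
    _ = _ := by norm_num; ring

/-- The affine embedding `ℝᵐ → ℝᵐ⁺¹` onto the hyperplane `{x | x i = s}`. -/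
noncomputable def insertCoord {m : ℕ} (i : Fin (m + 1)) (s : ℝ) (y : Space m) : Space (m + 1) :=
  WithLp.toLp 2 (i.insertNth (α := fun _ => ℝ) s y)

theorem isometry_insertCoord {m : ℕ} (i : Fin (m + 1)) (s : ℝ) : Isometry (insertCoord i s) := by
  refine Isometry.of_dist_eq fun x y => ?_
  rw [EuclideanSpace.dist_eq, EuclideanSpace.dist_eq, Fin.sum_univ_succAbove _ i]
  simp [insertCoord]

theorem norm_sq_insertCoord {m : ℕ} (i : Fin (m + 1)) (s : ℝ) (y : Space m) :
    ‖insertCoord i s y‖ ^ 2 = s ^ 2 + ‖y‖ ^ 2 := by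
  rw [EuclideanSpace.norm_sq_eq, EuclideanSpace.norm_sq_eq, Fin.sum_univ_succAbove _ i]
  simp [insertCoord]

/-- The unit sphere is covered by the radial projections of the faces `{x | x i = ±1}` of the cube
`[-1,1]ᵐ⁺¹`. -/
theorem unitSphere_subset_iUnion (m : ℕ) :
    Metric.sphere (0 : Space (m + 1)) 1 ⊆ ⋃ i : Fin (m + 1), ⋃ b : Bool,
      (fun x => ‖x‖⁻¹ • x) '' (insertCoord i (if b then 1 else -1) ''
        {y : Space m | ∀ j, |y j| ≤ 1}) := by
  intro x hx
  rw [mem_sphere_zero_iff_norm] at hx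
  -- The ray of `x` leaves the cube through a face of a coordinate of maximal modulus.
  obtain ⟨i, hi⟩ := Finite.exists_max (fun i => |x i|)
  have hi0 : 0 < |x i| := by
    refine (abs_nonneg _).lt_of_ne' fun h => ?_
    have : x = 0 := by
      ext j
      have := hi j
      rw [h] at this
      simpa using this
    simp [this] at hx
  have hne : x i ≠ 0 := abs_pos.1 hi0
  simp only [mem_iUnion]
  refine ⟨i, decide (0 < x i), insertCoord i (if decide (0 < x i) then 1 else -1)
    (WithLp.toLp 2 fun j => |x i|⁻¹ * x (i.succAbove j)), ⟨_, ?_, rfl⟩, ?_⟩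
  · intro j
    simp only [abs_mul, abs_inv, abs_abs]
    rw [inv_mul_le_one₀ hi0]
    exact hi _
  · have e : insertCoord i (if decide (0 < x i) then 1 else -1)
        (WithLp.toLp 2 fun j => |x i|⁻¹ * x (i.succAbove j)) = |x i|⁻¹ • x := by
      ext j
      refine Fin.succAboveCases i ?_ (fun j => ?_) j
      · simp only [insertCoord, Fin.insertNth_apply_same, PiLp.smul_apply, smul_eq_mul,
          decide_eq_true_eq]
        split_ifs with h
        · rw [abs_of_pos h, inv_mul_cancel₀ hne]
        · have : x i < 0 := lt_of_le_of_ne (not_lt.1 h) hne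
          rw [abs_of_neg this]; field_simp
      · simp [insertCoord]
    simp only [e, norm_smul, hx]
    rw [smul_smul]
    simp [hi0.ne']

theorem surfMeasure_unitSphere_lt_top (m : ℕ) :
    surfMeasure (m + 1) (Metric.sphere (0 : Space (m + 1)) 1) < ⊤ := by
  refine (measure_mono (unitSphere_subset_iUnion m)).trans_lt ?_
  refine (measure_iUnion_fintype_le _ _).trans_lt (ENNReal.sum_lt_top.2 fun i _ => ?_)
  refine (measure_iUnion_fintype_le _ _).trans_lt (ENNReal.sum_lt_top.2 fun b _ => ?_)
  set s : ℝ := if b then 1 else -1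
  have hs : s ^ 2 = 1 := by cases b <;> simp [s]
  have hsub : insertCoord i s '' {y : Space m | ∀ j, |y j| ≤ 1} ⊆ {x | 1 ≤ ‖x‖} := by
    rintro _ ⟨y, -, rfl⟩
    have h := norm_sq_insertCoord i s y
    have : (1 : ℝ) ≤ ‖insertCoord i s y‖ ^ 2 := by rw [h, hs]; nlinarith [norm_nonneg y]
    exact (one_le_sq_iff₀ (norm_nonneg _)).1 this
  refine (euclideanHausdorffMeasure_image_le (lipschitzOnWith_normalize.mono hsub) _).trans_lt ?_
  rw [(isometry_insertCoord i s).euclideanHausdorffMeasure_image, Nat.add_sub_cancel,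
    EuclideanSpace.euclideanHausdorffMeasure_eq_volume]
  refine ENNReal.mul_lt_top (by simp) (Bornology.IsBounded.measure_lt_top ?_)
  refine (Metric.isBounded_closedBall (x := (0 : Space m)) (r := √m)).subset fun y hy => ?_
  rw [mem_closedBall_zero_iff, EuclideanSpace.norm_eq]
  refine Real.sqrt_le_sqrt ?_
  calc ∑ j, ‖y j‖ ^ 2 ≤ ∑ _j : Fin m, (1 : ℝ) := by
        refine Finset.sum_le_sum fun j _ => ?_
        have := hy j
        rw [Real.norm_eq_abs]
        exact pow_le_one₀ (abs_nonneg _) this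
    _ = m := by simp

/-- Dropping a coordinate is `1`-Lipschitz, and the image of the sphere contains the unit ball of
`ℝᵐ`, which has positive volume. -/
theorem surfMeasure_unitSphere_pos (m : ℕ) :
    0 < surfMeasure (m + 1) (Metric.sphere (0 : Space (m + 1)) 1) := by
  let P : Space (m + 1) → Space m := fun x =>
    WithLp.toLp 2 fun j => x ((0 : Fin (m + 1)).succAbove j)
  have hP : LipschitzWith 1 P := by
    refine LipschitzWith.of_dist_le_mul fun x y => ?_
    rw [NNReal.coe_one, one_mul, EuclideanSpace.dist_eq, EuclideanSpace.dist_eq,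
      Fin.sum_univ_succAbove _ (0 : Fin (m + 1))]
    exact Real.sqrt_le_sqrt (le_add_of_nonneg_left (by positivity))
  have hsub : Metric.ball (0 : Space m) 1 ⊆ P '' Metric.sphere (0 : Space (m + 1)) 1 := by
    intro y hy
    rw [mem_ball_zero_iff] at hy
    refine ⟨insertCoord 0 (√(1 - ‖y‖ ^ 2)) y, ?_, ?_⟩
    · rw [mem_sphere_zero_iff_norm, ← sq_eq_sq₀ (norm_nonneg _) zero_le_one,
        norm_sq_insertCoord, Real.sq_sqrt (by nlinarith [norm_nonneg y])]
      ring
    · ext j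
      simp only [P, insertCoord, Fin.insertNth_apply_succAbove]
  have h1 : 0 < μHE[m] (Metric.ball (0 : Space m) 1) := by
    rw [EuclideanSpace.euclideanHausdorffMeasure_eq_volume]
    exact Metric.measure_ball_pos _ _ one_pos
  have h2 := euclideanHausdorffMeasure_image_le
    (hP.lipschitzOnWith (s := Metric.sphere (0 : Space (m + 1)) 1)) m
  have h3 := h1.trans_le ((measure_mono hsub).trans h2)
  simpa [surfMeasure] using h3

theorem surfMeasure_image_smul_add (r : ℝ) (z : Space n) (S : Set (Space n)) :
    surfMeasure n ((fun y => r • y + z) '' S) = surfMeasure n (r • S) := by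
  have : (fun y => r • y + z) '' S = (IsometryEquiv.addRight z) '' (r • S) := by
    rw [← image_smul, image_image]; rfl
  rw [this, surfMeasure, (IsometryEquiv.isometry _).euclideanHausdorffMeasure_image]

theorem surfMeasure_smul {r : ℝ} (hr : 0 < r) (S : Set (Space n)) :
    surfMeasure n (r • S) = ENNReal.ofReal (r ^ (n - 1)) * surfMeasure n S := by
  rw [surfMeasure, Measure.euclideanHausdorffMeasure_smul₀ _ hr.ne', ENNReal.smul_def, smul_eq_mul]
  congr 1
  rw [ENNReal.ofReal_pow hr.le, ← Real.enorm_eq_ofReal hr.le]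
  rfl

theorem refSurface_eq_image {R : ℝ} (hR : 0 < R) :
    refSurface n R =
      (fun y => R • y + WithLp.toLp 2 fun _ => (1 / 2 : ℝ)) '' Metric.sphere 0 1 := by
  have : (fun y : Space n => R • y + WithLp.toLp 2 fun _ => (1 / 2 : ℝ)) '' Metric.sphere 0 1 =
      (IsometryEquiv.addRight (WithLp.toLp 2 fun _ => (1 / 2 : ℝ))) ''
        (R • Metric.sphere (0 : Space n) 1) := by
    rw [← image_smul, image_image]; rfl
  rw [this, smul_sphere' hR.ne', IsometryEquiv.image_sphere]
  simp [refSurface, abs_of_pos hR]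

theorem surfMeasure_refSurface_pos (hn : 0 < n) {R : ℝ} (hR : 0 < R) :
    0 < surfMeasure n (refSurface n R) := by
  obtain ⟨m, rfl⟩ := Nat.exists_eq_succ_of_ne_zero hn.ne'
  rw [refSurface_eq_image hR, surfMeasure_image_smul_add, surfMeasure_smul hR]
  exact ENNReal.mul_pos (by simpa using pow_pos hR _) (surfMeasure_unitSphere_pos m).ne'

theorem surfMeasure_refSurface_lt_top (hn : 0 < n) {R : ℝ} (hR : 0 < R) :
    surfMeasure n (refSurface n R) < ⊤ := by
  obtain ⟨m, rfl⟩ := Nat.exists_eq_succ_of_ne_zero hn.ne'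
  rw [refSurface_eq_image hR, surfMeasure_image_smul_add, surfMeasure_smul hR]
  exact ENNReal.mul_lt_top ENNReal.ofReal_lt_top (surfMeasure_unitSphere_lt_top m)

/-! ### Cells and their surfaces -/

theorem cellIndices_finite (ℓ : Fin n → ℕ) {ε : ℝ} (hε : 0 < ε) : (cellIndices ℓ ε).Finite := by
  refine (Set.finite_Icc (fun _ : Fin n => (0 : ℤ)) (fun i => ⌈ε⁻¹ * ℓ i⌉)).subset fun k hk => ?_
  -- It suffices to use that the center of the cell lies in `Ω`.
  have h := hk (WithLp.toLp 2 fun _ => (1 / 2 : ℝ)) (fun i => by constructor <;> norm_num)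
  refine ⟨fun i => ?_, fun i => ?_⟩
  · have h1 := (h i).1
    simp only [intVec, PiLp.smul_apply, PiLp.add_apply, smul_eq_mul] at h1
    have h2 : (0 : ℝ) < 1 / 2 + k i := pos_of_mul_pos_right h1 hε.le
    have h3 : (-1 : ℝ) < k i := by linarith
    have h4 : (-1 : ℤ) < k i := by exact_mod_cast h3
    show 0 ≤ k i
    omega
  · have h1 := (h i).2
    simp only [intVec, PiLp.smul_apply, PiLp.add_apply, smul_eq_mul] at h1
    have h2 : 1 / 2 + (k i : ℝ) < ε⁻¹ * ℓ i := by rwa [lt_inv_mul_iff₀ hε]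
    have h3 : (k i : ℝ) ≤ (⌈ε⁻¹ * ℓ i⌉ : ℤ) := by linarith [Int.le_ceil (ε⁻¹ * (ℓ i : ℝ))]
    exact_mod_cast h3

/-- As `ε⁻¹` is an integer, the `ε`-cell of every point of `Ω` lies inside `Ω`: there is no boundary
layer. -/
theorem intPart_mem_cellIndices {ℓ : Fin n → ℕ} {ε : ℝ} (hε : 0 < ε) {N : ℕ} (hN : ε⁻¹ = N)
    {x : Space n} (hx : x ∈ macroDomain ℓ) : intPart (ε⁻¹ • x) ∈ cellIndices ℓ ε := by
  intro y hy i
  obtain ⟨h1, h2⟩ := hx i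
  have hk0 : 0 ≤ intPart (ε⁻¹ • x) i := by
    refine Int.floor_nonneg.2 ?_
    simp only [PiLp.smul_apply, smul_eq_mul]; positivity
  have hk1 : intPart (ε⁻¹ • x) i < N * ℓ i := by
    refine Int.floor_lt.2 ?_
    simp only [PiLp.smul_apply, smul_eq_mul, hN]
    push_cast
    have : (0 : ℝ) < N := hN ▸ inv_pos.2 hε
    gcongr
  have hk0' : (0 : ℝ) ≤ intPart (ε⁻¹ • x) i := by exact_mod_cast hk0
  have hk1' : (intPart (ε⁻¹ • x) i : ℝ) + 1 ≤ ε⁻¹ * ℓ i := by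
    have h : intPart (ε⁻¹ • x) i + 1 ≤ N * ℓ i := hk1
    calc (intPart (ε⁻¹ • x) i : ℝ) + 1 ≤ N * ℓ i := by exact_mod_cast h
      _ = ε⁻¹ * ℓ i := by rw [hN]
  have hk2 : (intPart (ε⁻¹ • x) i : ℝ) + y i < ε⁻¹ * ℓ i := by linarith [(hy i).2]
  simp only [intVec, PiLp.smul_apply, PiLp.add_apply, smul_eq_mul]
  constructor
  · have := (hy i).1; positivity
  · rw [lt_inv_mul_iff₀ hε] at hk2
    linarith

theorem refSurface_subset_unitCell {R : ℝ} (hR' : R < 1 / 2) : refSurface n R ⊆ unitCell n := by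
  intro y hy i
  rw [refSurface, mem_sphere_iff_norm] at hy
  have h := PiLp.norm_apply_le (y - WithLp.toLp 2 fun _ => (1 / 2 : ℝ)) i
  rw [hy, PiLp.sub_apply, Real.norm_eq_abs] at h
  have := abs_lt.1 (h.trans_lt hR')
  constructor <;> linarith [this.1, this.2]

theorem intPart_of_mem_cellSurface {R ε : ℝ} (hR' : R < 1 / 2) (hε : 0 < ε) {k : Fin n → ℤ}
    {z : Space n} (hz : z ∈ cellSurface R ε (ε • intVec k)) : intPart (ε⁻¹ • z) = k := by
  obtain ⟨y, hy, rfl⟩ := hz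
  funext i
  have h := refSurface_subset_unitCell hR' hy i
  simp only [intPart]
  rw [← smul_add, inv_smul_smul₀ hε.ne', Int.floor_eq_iff]
  simp only [intVec, PiLp.add_apply]
  constructor <;> linarith [h.1, h.2]

theorem isCompact_refSurface (n : ℕ) (R : ℝ) : IsCompact (refSurface n R) := isCompact_sphere _ _

theorem isCompact_cellSurface (R ε : ℝ) (z : Space n) : IsCompact (cellSurface R ε z) :=
  (isCompact_refSurface n R).image (by fun_prop)

theorem cellSurface_pairwiseDisjoint {R ε : ℝ} (hR' : R < 1 / 2) (hε : 0 < ε)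
    (s : Set (Fin n → ℤ)) :
    s.Pairwise (Function.onFun Disjoint fun k => cellSurface R ε (ε • intVec k)) := by
  intro k _ k' _ hne
  refine Set.disjoint_left.2 fun z hz hz' => hne ?_
  rw [← intPart_of_mem_cellSurface hR' hε hz, ← intPart_of_mem_cellSurface hR' hε hz']

theorem surfMeasure_cellSurface (R ε : ℝ) (z : Space n) :
    surfMeasure n (cellSurface R ε z) = surfMeasure n (ε • refSurface n R) :=
  surfMeasure_image_smul_add _ _ _

theorem surfMeasure_cellSurface_lt_top (hn : 0 < n) {R ε : ℝ} (hR : 0 < R) (hε : 0 < ε)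
    (z : Space n) : surfMeasure n (cellSurface R ε z) < ⊤ := by
  rw [surfMeasure_cellSurface, surfMeasure_smul hε]
  exact ENNReal.mul_lt_top ENNReal.ofReal_lt_top (surfMeasure_refSurface_lt_top hn hR)

theorem surfMeasure_oscSurface_lt_top (hn : 0 < n) (ℓ : Fin n → ℕ) {R ε : ℝ} (hR : 0 < R)
    (hε : 0 < ε) : surfMeasure n (oscSurface ℓ R ε) < ⊤ :=
  measure_biUnion_lt_top (cellIndices_finite ℓ hε)
    fun _ _ => surfMeasure_cellSurface_lt_top hn hR hε _

theorem surfMeasure_real_smul_refSurface {R ε : ℝ} (hε : 0 < ε) :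
    (surfMeasure n).real (ε • refSurface n R) =
      ε ^ (n - 1) * (surfMeasure n).real (refSurface n R) := by
  rw [measureReal_def, surfMeasure_smul hε, ENNReal.toReal_mul,
    ENNReal.toReal_ofReal (by positivity)]
  rfl

theorem surfMeasure_real_refSurface_pos (hn : 0 < n) {R : ℝ} (hR : 0 < R) :
    0 < (surfMeasure n).real (refSurface n R) :=
  ENNReal.toReal_pos (surfMeasure_refSurface_pos hn hR).ne' (surfMeasure_refSurface_lt_top hn hR).ne

theorem measurableSet_macroDomain (ℓ : Fin n → ℕ) : MeasurableSet (macroDomain ℓ) := by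
  have : macroDomain ℓ = ⋂ i, {x : Space n | 0 < x i} ∩ {x : Space n | x i < ℓ i} := by
    ext x; simp [macroDomain]
  rw [this]
  exact MeasurableSet.iInter fun i =>
    (measurableSet_lt (by fun_prop) (by fun_prop)).inter
      (measurableSet_lt (by fun_prop) (by fun_prop))

theorem volume_box (a b : Fin n → ℝ) :
    volume {x : Space n | ∀ i, a i ≤ x i ∧ x i ≤ b i} = ∏ i, ENNReal.ofReal (b i - a i) := by
  have : {x : Space n | ∀ i, a i ≤ x i ∧ x i ≤ b i} = WithLp.ofLp ⁻¹' (Icc a b) := by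
    ext x; simp [Pi.le_def, forall_and]
  rw [this, (PiLp.volume_preserving_ofLp (Fin n)).measure_preimage
    measurableSet_Icc.nullMeasurableSet, Real.volume_Icc_pi]

theorem volume_macroDomain_lt_top (ℓ : Fin n → ℕ) : volume (macroDomain ℓ) < ⊤ := by
  refine (measure_mono (t := {x : Space n | ∀ i, (0 : ℝ) ≤ x i ∧ x i ≤ ℓ i})
    fun x hx i => ⟨(hx i).1.le, (hx i).2.le⟩).trans_lt ?_
  rw [volume_box (fun _ => 0) (fun i => (ℓ i : ℝ))]
  exact ENNReal.prod_lt_top fun _ _ => ENNReal.ofReal_lt_top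

/-- The half-open cell of side `ε` with index `k`, consisting of the points `x` with
`[x/ε] = k`. -/
def gridCell (ε : ℝ) (k : Fin n → ℤ) : Set (Space n) := {x | intPart (ε⁻¹ • x) = k}

theorem measurableSet_gridCell (ε : ℝ) (k : Fin n → ℤ) : MeasurableSet (gridCell ε k) := by
  have : gridCell ε k = ⋂ i, (fun x : Space n => ⌊ε⁻¹ * x i⌋) ⁻¹' {k i} := by
    ext x; simp [gridCell, intPart, funext_iff]
  rw [this]
  exact MeasurableSet.iInter fun i =>
    (Int.measurable_floor.comp (by fun_prop)) (measurableSet_singleton _)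

theorem mul_le_and_le_of_mem_gridCell {ε : ℝ} (hε : 0 < ε) {k : Fin n → ℤ} {x : Space n}
    (hx : x ∈ gridCell ε k) (i : Fin n) : ε * k i ≤ x i ∧ x i ≤ ε * (k i + 1) := by
  have h : ⌊ε⁻¹ * x i⌋ = k i := congrFun hx i
  obtain ⟨h1, h2⟩ := Int.floor_eq_iff.1 h
  rw [le_inv_mul_iff₀ hε] at h1
  rw [inv_mul_lt_iff₀ hε] at h2
  exact ⟨h1, h2.le⟩

theorem volume_real_gridCell_le {ε : ℝ} (hε : 0 < ε) (k : Fin n → ℤ) (Ω : Set (Space n)) :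
    (volume.restrict Ω).real (gridCell ε k) ≤ ε ^ n := by
  refine ENNReal.toReal_le_of_le_ofReal (by positivity) ?_
  refine (Measure.restrict_apply_le _ _).trans ((measure_mono
    (t := {x : Space n | ∀ i, ε * k i ≤ x i ∧ x i ≤ ε * (k i + 1)}) (fun x hx =>
    mul_le_and_le_of_mem_gridCell hε hx)).trans ?_)
  rw [volume_box (fun i => ε * (k i : ℝ)) (fun i => ε * ((k i : ℝ) + 1))]
  have : ∀ i, ε * ((k i : ℝ) + 1) - ε * k i = ε := fun i => by ring
  simp [this, ENNReal.ofReal_pow hε.le]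

/-- The distance between a point of the `ε`-cell with index `k` and a point of the surface in this
cell is at most `ε n`, as the coordinates differ by at most `ε`. -/
theorem dist_le_of_mem_cellSurface {R ε : ℝ} (hR' : R < 1 / 2) (hε : 0 < ε) {k : Fin n → ℤ}
    {x z : Space n} (hx : x ∈ gridCell ε k) (hz : z ∈ cellSurface R ε (ε • intVec k)) :
    dist z x ≤ ε * n := by
  have hz' : z ∈ gridCell ε k := intPart_of_mem_cellSurface hR' hε hz
  have hc : ∀ i, ‖(z - x) i‖ ≤ ε := fun i => by
    have h1 := mul_le_and_le_of_mem_gridCell hε hx i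
    have h2 := mul_le_and_le_of_mem_gridCell hε hz' i
    rw [PiLp.sub_apply, Real.norm_eq_abs, abs_le]
    constructor <;> linarith [h1.1, h1.2, h2.1, h2.2]
  rw [dist_eq_norm]
  have hs : ‖z - x‖ ≤ ∑ i, ‖(z - x) i‖ := by
    rw [EuclideanSpace.norm_eq]
    refine Real.sqrt_le_iff.2 ⟨by positivity, ?_⟩
    exact Finset.sum_sq_le_sq_sum_of_nonneg fun i _ => norm_nonneg _
  calc ‖z - x‖ ≤ ∑ i, ‖(z - x) i‖ := hs
    _ ≤ ∑ _i : Fin n, ε := Finset.sum_le_sum fun i _ => hc i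
    _ = ε * n := by simp [mul_comm]

/-! ### Averaging over the surfaces of the cells -/

instance isFiniteMeasure_timeMeasure (T : ℝ) : IsFiniteMeasure (timeMeasure T) := by
  unfold timeMeasure; infer_instance

theorem isFiniteMeasure_restrict_oscSurface (hn : 0 < n) (ℓ : Fin n → ℕ) {R ε : ℝ} (hR : 0 < R)
    (hε : 0 < ε) : IsFiniteMeasure ((surfMeasure n).restrict (oscSurface ℓ R ε)) :=
  isFiniteMeasure_restrict.2 (surfMeasure_oscSurface_lt_top hn ℓ hR hε).ne

instance isFiniteMeasure_restrict_macroDomain (ℓ : Fin n → ℕ) :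
    IsFiniteMeasure (volume.restrict (macroDomain ℓ)) :=
  isFiniteMeasure_restrict.2 (volume_macroDomain_lt_top ℓ).ne

instance isFiniteMeasure_macroMeasure (T : ℝ) (ℓ : Fin n → ℕ) :
    IsFiniteMeasure (macroMeasure T ℓ) := by
  unfold macroMeasure; infer_instance

theorem ae_macroMeasure_snd_mem (T : ℝ) (ℓ : Fin n → ℕ) :
    ∀ᵐ p ∂(macroMeasure T ℓ), p.2 ∈ macroDomain ℓ :=
  Measure.quasiMeasurePreserving_snd.ae (ae_restrict_mem (measurableSet_macroDomain ℓ))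

theorem cellSurface_subset_oscSurface {ℓ : Fin n → ℕ} {R ε : ℝ} {k : Fin n → ℤ}
    (hk : k ∈ cellIndices ℓ ε) : cellSurface R ε (ε • intVec k) ⊆ oscSurface ℓ R ε :=
  subset_biUnion_of_mem (u := fun k => cellSurface R ε (ε • intVec k)) hk

theorem integrable_restrict_cellSurface (hn : 0 < n) {T : ℝ} {ℓ : Fin n → ℕ} {R ε : ℝ} (hR : 0 < R)
    (hε : 0 < ε) {f : ℝ × Space n → ℝ} (hf : Integrable f (oscMeasure T ℓ R ε)) {k : Fin n → ℤ}
    (hk : k ∈ cellIndices ℓ ε) :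
    Integrable f ((timeMeasure T).prod
      ((surfMeasure n).restrict (cellSurface R ε (ε • intVec k)))) := by
  have := isFiniteMeasure_restrict_oscSurface hn ℓ hR hε
  exact hf.mono_measure (Measure.prod_mono le_rfl
    (Measure.restrict_mono (cellSurface_subset_oscSurface hk) le_rfl))

/-- The average of `f(t, ·)` over the surface in the cell with index `k`. -/
noncomputable def indexAverage (R ε : ℝ) (f : ℝ × Space n → ℝ) (k : Fin n → ℤ) (t : ℝ) : ℝ :=
  ((surfMeasure n).real (ε • refSurface n R))⁻¹ *
    ∫ z in cellSurface R ε (ε • intVec k), f (t, z) ∂(surfMeasure n)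

theorem integrable_indexAverage (hn : 0 < n) {T : ℝ} {ℓ : Fin n → ℕ} {R ε : ℝ} (hR : 0 < R)
    (hε : 0 < ε) {f : ℝ × Space n → ℝ} (hf : Integrable f (oscMeasure T ℓ R ε)) {k : Fin n → ℤ}
    (hk : k ∈ cellIndices ℓ ε) : Integrable (indexAverage R ε f k) (timeMeasure T) := by
  have : IsFiniteMeasure ((surfMeasure n).restrict (cellSurface R ε (ε • intVec k))) :=
    isFiniteMeasure_restrict.2 (surfMeasure_cellSurface_lt_top hn hR hε _).ne
  exact (integrable_restrict_cellSurface hn hR hε hf hk).integral_prod_left.const_mul _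

theorem cellAverage_ae_eq_sum {T : ℝ} {ℓ : Fin n → ℕ} {R ε : ℝ} (hε : 0 < ε) {N : ℕ}
    (hN : ε⁻¹ = N) (f : ℝ × Space n → ℝ) :
    cellAverage R ε f =ᵐ[macroMeasure T ℓ] fun p => ∑ k ∈ (cellIndices_finite ℓ hε).toFinset,
      indexAverage R ε f k p.1 * (gridCell ε k).indicator 1 p.2 := by
  filter_upwards [ae_macroMeasure_snd_mem T ℓ] with p hp
  rw [Finset.sum_eq_single (intPart (ε⁻¹ • p.2))]
  · rw [indicator_of_mem (show p.2 ∈ gridCell ε (intPart (ε⁻¹ • p.2)) from rfl)]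
    simp [cellAverage, indexAverage]
  · intro k _ hk
    rw [indicator_of_notMem fun h : p.2 ∈ gridCell ε k => hk (Eq.symm h), mul_zero]
  · intro h
    exact absurd ((cellIndices_finite ℓ hε).mem_toFinset.2 (intPart_mem_cellIndices hε hN hp)) h

theorem integrable_indexAverage_mul_indicator (hn : 0 < n) {T : ℝ} {ℓ : Fin n → ℕ} {R ε : ℝ}
    (hR : 0 < R) (hε : 0 < ε) {f : ℝ × Space n → ℝ} (hf : Integrable f (oscMeasure T ℓ R ε))
    {k : Fin n → ℤ} (hk : k ∈ cellIndices ℓ ε) :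
    Integrable (fun p : ℝ × Space n => indexAverage R ε f k p.1 * (gridCell ε k).indicator 1 p.2)
      (macroMeasure T ℓ) :=
  (integrable_indexAverage hn hR hε hf hk).mul_prod
    ((integrable_const (1 : ℝ)).indicator (measurableSet_gridCell ε k))

theorem integrable_cellAverage (hn : 0 < n) {T : ℝ} {ℓ : Fin n → ℕ} {R ε : ℝ} (hR : 0 < R)
    (hε : 0 < ε) {N : ℕ} (hN : ε⁻¹ = N) {f : ℝ × Space n → ℝ}
    (hf : Integrable f (oscMeasure T ℓ R ε)) :
    Integrable (cellAverage R ε f) (macroMeasure T ℓ) := by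
  refine (integrable_finsetSum _ fun k hk => ?_).congr (cellAverage_ae_eq_sum hε hN f).symm
  exact integrable_indexAverage_mul_indicator hn hR hε hf
    ((cellIndices_finite ℓ hε).mem_toFinset.1 hk)

theorem integral_oscMeasure_eq_sum (hn : 0 < n) {T : ℝ} {ℓ : Fin n → ℕ} {R ε : ℝ} (hR : 0 < R)
    (hR' : R < 1 / 2) (hε : 0 < ε) {f : ℝ × Space n → ℝ}
    (hf : Integrable f (oscMeasure T ℓ R ε)) :
    ∫ p, f p ∂(oscMeasure T ℓ R ε) = ∑ k ∈ (cellIndices_finite ℓ hε).toFinset,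
      ∫ t, ∫ z in cellSurface R ε (ε • intVec k), f (t, z) ∂(surfMeasure n) ∂(timeMeasure T) := by
  have := isFiniteMeasure_restrict_oscSurface hn ℓ hR hε
  have hfin : ∀ k : Fin n → ℤ,
      IsFiniteMeasure ((surfMeasure n).restrict (cellSurface R ε (ε • intVec k))) := fun k =>
    isFiniteMeasure_restrict.2 (surfMeasure_cellSurface_lt_top hn hR hε _).ne
  have hosc : oscSurface ℓ R ε =
      ⋃ k ∈ (cellIndices_finite ℓ hε).toFinset, cellSurface R ε (ε • intVec k) := by
    simp [oscSurface]
  rw [← integral_finsetSum _ fun k hk => (integrable_restrict_cellSurface hn hR hε hf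
    ((cellIndices_finite ℓ hε).mem_toFinset.1 hk)).integral_prod_left, oscMeasure,
    integral_prod _ hf]
  refine integral_congr_ae ?_
  filter_upwards [hf.prod_right_ae] with t ht
  rw [hosc]
  refine integral_biUnion_finset _ (fun k _ => (isCompact_cellSurface _ _ _).measurableSet)
    (cellSurface_pairwiseDisjoint hR' hε _) fun k hk => ?_
  exact IntegrableOn.mono_set (t := oscSurface ℓ R ε) ht
    (cellSurface_subset_oscSurface ((cellIndices_finite ℓ hε).mem_toFinset.1 hk))

/-- Averaging over cells is bounded from `L¹((0,T) × Γ_ε)`, weighted by `ε`, to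
`L¹((0,T) × Ω)`: a cell has volume at most `εⁿ`, and its surface has area `εⁿ⁻¹ |Γ|`. -/
theorem integral_cellAverage_le (hn : 0 < n) {T : ℝ} {ℓ : Fin n → ℕ} {R ε : ℝ} (hR : 0 < R)
    (hR' : R < 1 / 2) (hε : 0 < ε) {N : ℕ} (hN : ε⁻¹ = N) {f : ℝ × Space n → ℝ}
    (hf : Integrable f (oscMeasure T ℓ R ε)) (hf0 : 0 ≤ f) :
    ∫ p, cellAverage R ε f p ∂(macroMeasure T ℓ) ≤
      ((surfMeasure n).real (refSurface n R))⁻¹ * (ε * ∫ p, f p ∂(oscMeasure T ℓ R ε)) := by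
  rw [integral_congr_ae (cellAverage_ae_eq_sum hε hN f), integral_finsetSum _ fun k hk =>
    integrable_indexAverage_mul_indicator hn hR hε hf
      ((cellIndices_finite ℓ hε).mem_toFinset.1 hk),
    integral_oscMeasure_eq_sum hn hR hR' hε hf, Finset.mul_sum, Finset.mul_sum]
  refine Finset.sum_le_sum fun k _ => ?_
  rw [macroMeasure, integral_prod_mul, integral_indicator_one (measurableSet_gridCell ε k)]
  simp only [indexAverage]
  rw [integral_const_mul, surfMeasure_real_smul_refSurface hε]
  have hσ := surfMeasure_real_refSurface_pos hn hR
  have hI : 0 ≤ ∫ t, ∫ z in cellSurface R ε (ε • intVec k), f (t, z) ∂(surfMeasure n)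
      ∂(timeMeasure T) := integral_nonneg fun t => integral_nonneg fun z => hf0 _
  generalize (∫ t, ∫ z in cellSurface R ε (ε • intVec k), f (t, z) ∂(surfMeasure n)
      ∂(timeMeasure T)) = I at hI ⊢
  calc _ ≤ (ε ^ (n - 1) * (surfMeasure n).real (refSurface n R))⁻¹ * I * ε ^ n := by
        gcongr; exact volume_real_gridCell_le hε k _
    _ = _ := by
        obtain ⟨m, rfl⟩ := Nat.exists_eq_succ_of_ne_zero hn.ne'
        rw [Nat.succ_sub_one, pow_succ]
        field_simp

/-- The error made by averaging `f` over a surface instead of taking the value `φ(t,x)` at a point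
of the cell is controlled by the average of `|f - φ|` and by the oscillation `η` of `φ` in the
cell. -/
theorem abs_cellAverage_sub_le (hn : 0 < n) {R ε : ℝ} (hR : 0 < R) (hR' : R < 1 / 2) (hε : 0 < ε)
    {f φ : ℝ × Space n → ℝ} (hφ : Continuous φ) {η : ℝ}
    (hη : ∀ p q, dist p q ≤ ε * n → |φ p - φ q| ≤ η) {t : ℝ} {x : Space n}
    (hf : IntegrableOn (fun z => f (t, z))
      (cellSurface R ε (ε • intVec (intPart (ε⁻¹ • x)))) (surfMeasure n)) :
    |cellAverage R ε f (t, x) - φ (t, x)| ≤ cellAverage R ε (fun q => |f q - φ q|) (t, x) + η := by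
  set S := cellSurface R ε (ε • intVec (intPart (ε⁻¹ • x))) with hS
  set A := (surfMeasure n).real (ε • refSurface n R) with hA
  have hA0 : 0 < A := by
    rw [hA, surfMeasure_real_smul_refSurface hε]
    exact mul_pos (pow_pos hε _) (surfMeasure_real_refSurface_pos hn hR)
  have hSA : (surfMeasure n).real S = A := by rw [measureReal_def, surfMeasure_cellSurface]; rfl
  have hfin : surfMeasure n S < ⊤ := surfMeasure_cellSurface_lt_top hn hR hε _
  have : IsFiniteMeasure ((surfMeasure n).restrict S) := isFiniteMeasure_restrict.2 hfin.ne
  have hφi : IntegrableOn (fun z => φ (t, z)) S (surfMeasure n) :=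
    ContinuousOn.integrableOn_of_subset_isCompact (K := S) (by fun_prop)
      (isCompact_cellSurface _ _ _) (isCompact_cellSurface _ _ _).measurableSet le_rfl hfin.ne
  have hfφ : IntegrableOn (fun z => |f (t, z) - φ (t, z)|) S (surfMeasure n) := (hf.sub hφi).abs
  have hc : cellAverage R ε f (t, x) - φ (t, x) =
      A⁻¹ * ∫ z in S, (f (t, z) - φ (t, x)) ∂(surfMeasure n) := by
    rw [integral_sub hf (integrable_const _), integral_const, measureReal_restrict_apply_univ, hSA,
      smul_eq_mul, mul_sub, inv_mul_cancel_left₀ hA0.ne']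
    rfl
  have hd : cellAverage R ε (fun q => |f q - φ q|) (t, x) + η =
      A⁻¹ * ∫ z in S, (|f (t, z) - φ (t, z)| + η) ∂(surfMeasure n) := by
    rw [integral_add hfφ (integrable_const _), integral_const,
      measureReal_restrict_apply_univ, hSA, smul_eq_mul, mul_add, inv_mul_cancel_left₀ hA0.ne']
    rfl
  rw [hc, hd, abs_mul, abs_of_pos (inv_pos.2 hA0)]
  refine mul_le_mul_of_nonneg_left (abs_integral_le_integral_abs.trans ?_) (inv_pos.2 hA0).le
  refine setIntegral_mono_on (hf.sub (integrable_const _)).abs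
    (hfφ.add (integrable_const _)) (isCompact_cellSurface _ _ _).measurableSet
    fun z hz => ?_
  have h1 : |φ (t, z) - φ (t, x)| ≤ η := by
    refine hη _ _ ?_
    rw [dist_prod_same_left]
    exact dist_le_of_mem_cellSurface hR' hε rfl hz
  calc |f (t, z) - φ (t, x)| ≤ |f (t, z) - φ (t, z)| + |φ (t, z) - φ (t, x)| := abs_sub_le _ _ _
    _ ≤ _ := by gcongr

/-- The cell averages of `f` are close to `u` in `L¹((0,T) × Ω)` as soon as some `φ` of small
oscillation is close to `f` on the surfaces and to `u` in the domain. -/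
theorem integral_abs_cellAverage_sub_le (hn : 0 < n) {T : ℝ} {ℓ : Fin n → ℕ} {R ε : ℝ}
    (hR : 0 < R) (hR' : R < 1 / 2) (hε : 0 < ε) {N : ℕ} (hN : ε⁻¹ = N) {f φ u : ℝ × Space n → ℝ}
    (hf : Integrable f (oscMeasure T ℓ R ε)) (hu : Integrable u (macroMeasure T ℓ))
    (hφ : Continuous φ) (hφc : HasCompactSupport φ) {η : ℝ}
    (hη : ∀ p q, dist p q ≤ ε * n → |φ p - φ q| ≤ η) :
    ∫ p, |cellAverage R ε f p - u p| ∂(macroMeasure T ℓ) ≤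
      ((surfMeasure n).real (refSurface n R))⁻¹ *
        (ε * ∫ p, |f p - φ p| ∂(oscMeasure T ℓ R ε)) +
      η * (macroMeasure T ℓ).real univ + ∫ p, |u p - φ p| ∂(macroMeasure T ℓ) := by
  have := isFiniteMeasure_restrict_oscSurface hn ℓ hR hε
  have : IsFiniteMeasure (oscMeasure T ℓ R ε) := by unfold oscMeasure; infer_instance
  have hfφ : Integrable (fun p => |f p - φ p|) (oscMeasure T ℓ R ε) :=
    (hf.sub (hφ.integrable_of_hasCompactSupport hφc)).abs
  have huφ : Integrable (fun p => |u p - φ p|) (macroMeasure T ℓ) :=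
    (hu.sub (hφ.integrable_of_hasCompactSupport hφc)).abs
  have hA := integrable_cellAverage hn hR hε hN hf
  have hB := integrable_cellAverage hn hR hε hN hfφ
  have hBη : Integrable (fun p => cellAverage R ε (fun q => |f q - φ q|) p + η)
      (macroMeasure T ℓ) := hB.add (integrable_const _)
  have hae : ∀ᵐ p ∂(macroMeasure T ℓ), |cellAverage R ε f p - u p| ≤
      cellAverage R ε (fun q => |f q - φ q|) p + η + |u p - φ p| := by
    have h1 : ∀ᵐ p ∂(macroMeasure T ℓ), IntegrableOn (fun z => f (p.1, z)) (oscSurface ℓ R ε)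
        (surfMeasure n) := Measure.quasiMeasurePreserving_fst.ae hf.prod_right_ae
    filter_upwards [h1, ae_macroMeasure_snd_mem T ℓ] with p hp hx
    have h2 := abs_cellAverage_sub_le hn hR hR' hε hφ hη (t := p.1) (x := p.2)
      (hp.mono_set (cellSurface_subset_oscSurface (intPart_mem_cellIndices hε hN hx)))
    calc |cellAverage R ε f p - u p| ≤ |cellAverage R ε f p - φ p| + |φ p - u p| :=
          abs_sub_le _ _ _
      _ ≤ _ := by rw [abs_sub_comm (φ p)]; gcongr
  calc _ ≤ ∫ p, (cellAverage R ε (fun q => |f q - φ q|) p + η + |u p - φ p|)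
        ∂(macroMeasure T ℓ) :=
        integral_mono_ae (hA.sub hu).abs (hBη.add huφ) hae
    _ = ∫ p, cellAverage R ε (fun q => |f q - φ q|) p ∂(macroMeasure T ℓ) +
        η * (macroMeasure T ℓ).real univ + ∫ p, |u p - φ p| ∂(macroMeasure T ℓ) := by
        rw [integral_add hBη huφ, integral_add hB (integrable_const _),
          integral_const, smul_eq_mul, mul_comm]
    _ ≤ _ := by
        gcongr
        exact integral_cellAverage_le hn hR hR' hε hN hfφ fun _ => abs_nonneg _

theorem integral_twoScaleMeasure_of_macro (hn : 0 < n) (T : ℝ) (ℓ : Fin n → ℕ) {R : ℝ} (hR : 0 < R)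
    (g : ℝ × Space n → ℝ) :
    ∫ q, g (q.1, q.2.1) ∂(twoScaleMeasure T ℓ R) =
      (surfMeasure n).real (refSurface n R) * ∫ p, g p ∂(macroMeasure T ℓ) := by
  have : IsFiniteMeasure ((surfMeasure n).restrict (refSurface n R)) :=
    isFiniteMeasure_restrict.2 (surfMeasure_refSurface_lt_top hn hR).ne
  rw [twoScaleMeasure, ← Measure.prodAssoc_prod, integral_map_equiv]
  have := integral_fun_fst (μ := macroMeasure T ℓ)
    (ν := (surfMeasure n).restrict (refSurface n R)) g
  rw [measureReal_restrict_apply_univ, smul_eq_mul] at this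
  exact this

end TwoScale

theorem mainTheorem5
    (n : ℕ) (hn : 0 < n)
    (ℓ : Fin n → ℕ) (hℓ : ∀ i, 0 < ℓ i)
    (T : ℝ) (hT : 0 < T)
    (R : ℝ) (hR : 0 < R) (hR' : R < 1 / 2)
    (ε : ℕ → ℝ) (hε : ∀ j, 0 < ε j) (hεN : ∀ j, ∃ N : ℕ, (ε j)⁻¹ = (N : ℝ))
    (hε0 : Tendsto ε atTop (𝓝 0))
    (w : ℕ → ℝ × TwoScale.Space n → ℝ)
    (hw : ∀ j, Integrable (w j) (TwoScale.oscMeasure T ℓ R (ε j)))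
    (w₀ : ℝ × TwoScale.Space n → ℝ)
    (hw₀ : TwoScale.MemL1W11 T ℓ w₀)
    (hconv : TwoScale.StrongTwoScaleTendsto T ℓ R ε w (fun q => w₀ (q.1, q.2.1))) :
    (∀ j, Integrable (TwoScale.cellAverage R (ε j) (w j)) (TwoScale.macroMeasure T ℓ)) ∧
    Tendsto
      (fun j => ∫ p, |TwoScale.cellAverage R (ε j) (w j) p - w₀ p| ∂(TwoScale.macroMeasure T ℓ))
      atTop (𝓝 0) := by
  have hint : ∀ j, Integrable (TwoScale.cellAverage R (ε j) (w j)) (TwoScale.macroMeasure T ℓ) :=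
    fun j => let ⟨_, hN⟩ := hεN j; TwoScale.integrable_cellAverage hn hR (hε j) hN (hw j)
  refine ⟨hint, ?_⟩
  rw [Metric.tendsto_nhds]
  intro δ hδ
  -- The error estimate below tends to `2 ‖w₀ - φ‖` plus the oscillation term: with `δ / 4` here and
  -- for the latter, it is eventually less than `δ / 2 + δ / 4 + δ / 4`.
  obtain ⟨φ, hφc, hφle, hφ, -⟩ :=
    hw₀.1.exists_hasCompactSupport_integral_sub_le (show 0 < δ / 4 by positivity)
  simp only [Real.norm_eq_abs] at hφle
  set σ := (TwoScale.surfMeasure n).real (TwoScale.refSurface n R)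
  have hσ : 0 < σ := TwoScale.surfMeasure_real_refSurface_pos hn hR
  set V := (TwoScale.macroMeasure T ℓ).real univ
  have hV : 0 ≤ V := measureReal_nonneg
  -- For the test function `(t, x, y) ↦ φ (t, x)`, which does not oscillate, the convergence of the
  -- norms says that `|Γ|⁻¹ ε ‖w_ε - φ‖` tends to `‖w₀ - φ‖`.
  have hlim : Tendsto (fun j => σ⁻¹ * (ε j * ∫ p, |w j p - φ p|
      ∂(TwoScale.oscMeasure T ℓ R (ε j)))) atTop
      (𝓝 (∫ p, |w₀ p - φ p| ∂(TwoScale.macroMeasure T ℓ))) := by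
    have h := (hconv.norm_tendsto (fun q => φ (q.1, q.2.1))
      (Continuous.continuousOn (by fun_prop))).const_mul σ⁻¹
    rw [TwoScale.integral_twoScaleMeasure_of_macro hn T ℓ hR fun p => |w₀ p - φ p|,
      inv_mul_cancel_left₀ hσ.ne'] at h
    exact h
  obtain ⟨r, hr, hφr⟩ := Metric.uniformContinuous_iff.1
    (hφc.uniformContinuous_of_continuous hφ) (δ / (4 * (V + 1))) (by positivity)
  have hsmall : ∀ᶠ j in atTop, ε j * n < r := by
    have : Tendsto (fun j => ε j * n) atTop (𝓝 0) := by simpa using hε0.mul_const (n : ℝ)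
    exact this.eventually_lt_const hr
  filter_upwards [hlim.eventually_lt_const (show _ < δ / 2 by linarith), hsmall] with j hj hjr
  obtain ⟨N, hN⟩ := hεN j
  have hmain := TwoScale.integral_abs_cellAverage_sub_le hn hR hR' (hε j) hN (hw j) hw₀.1 hφ hφc
    fun p q hpq => (hφr (hpq.trans_lt hjr)).le
  have hηV : δ / (4 * (V + 1)) * V ≤ δ / 4 := by
    rw [div_mul_eq_mul_div, div_le_div_iff₀ (by positivity) (by positivity)]
    nlinarith
  rw [dist_zero_right, Real.norm_eq_abs, abs_of_nonneg (integral_nonneg fun _ => abs_nonneg _)]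
  linarith
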